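/- Let $\mathcal H$ be a separable complex Hilbert space, $d\in\mathbb N$ and $1\le p<\infty$. For a $d$-tuple $\mathbf T=(T_1,\dots,T_d)$ of bounded linear operators on $\mathcal H$ put $P=\left(\sum_{i=1}^d T_i^*T_i\right)^{1/2}$. We write $\mathbf T\in\mathfrak C_p^d(\mathcal H)$ if $\operatorname{tr}(P^p)=\sum_j\langle P^pe_j,e_j\rangle<\infty$, where $(e_j)$ is an orthonormal basis of $\mathcal H$ (the value in $[0,\infty]$ does not depend on the basis), and in that case $\|\mathbf T\|_{s,p}=\left[\operatorname{tr}(P^p)\right]^{1/p}$. Let $\mathbf T=\mathbf VP=(V_1P,\dots,V_dP)$ be the canonical spherical polar decomposition, that is, $\mathbf V=(V_1,\dots,V_d)$ is the unique $d$-tuple of bounded operators such that $T_i=V_iP$ for all $i$ and $\sum_{i=1}^dV_i^*V_i$ is the orthogonal projection onto $\mathcal N(P)^\perp$. Define $$\mathbf T^D=(PV_1,\dots,PV_d),\qquad \widehat{\mathbf T}=\tfrac12(\mathbf T+\mathbf T^D),\qquad \mathbf M_\lambda(\mathbf T)=\lambda\mathbf T+(1-\lambda)\mathbf T^D\quad(0\le\lambda\le1).$$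 Theorem. If $\mathbf T\in\mathfrak C_p^d(\mathcal H)$, then for every $\lambda\in[0,1]$ we have $\mathbf M_\lambda(\mathbf T)\in\mathfrak C_p^d(\mathcal H)$ and $$\|\mathbf M_\lambda(\mathbf T)\|_{s,p}\le\left(\lambda+(1-\lambda)\sqrt[p]{d}\right)\|\mathbf T\|_{s,p}.$$ In particular, $\mathbf T^D,\widehat{\mathbf T}\in\mathfrak C_p^d(\mathcal H)$ with $$\|\mathbf T^D\|_{s,p}\le\sqrt[p]{d}\,\|\mathbf T\|_{s,p}\qquad\text{and}\qquad\|\widehat{\mathbf T}\|_{s,p}\le\frac{1+\sqrt[p]{d}}2\,\|\mathbf T\|_{s,p}.$$ -/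

import Mathlib

open scoped ENNReal InnerProductSpace

noncomputable section

namespace SphericalSchatten

variable {H : Type*} [NormedAddCommGroup H] [InnerProductSpace ℂ H] [CompleteSpace H] {d : ℕ}

/-- The trace of a positive operator `A`, as an element of `[0, ∞]`: the sum `∑ ⟨A e, e⟩` over an
orthonormal (Hilbert) basis of `H`. By `posTrace_eq_tsum` below the choice of the basis is
irrelevant. It is only used for positive operators, where every term is a nonnegative real. -/
def posTrace (A : H →L[ℂ] H) : ℝ≥0∞ :=
  ∑' e : (exists_hilbertBasis ℂ H).choose,
    ENNReal.ofReal (RCLike.re ⟪((exists_hilbertBasis ℂ H).choose_spec.choose e : H),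
      A ((exists_hilbertBasis ℂ H).choose_spec.choose e)⟫_ℂ)

theorem tsum_normSq {ι : Type*} (b : HilbertBasis ι ℂ H) (x : H) :
    ∑' i, ENNReal.ofReal (‖⟪b i, x⟫_ℂ‖ ^ 2) = ENNReal.ofReal (‖x‖ ^ 2) := by
  have h := b.hasSum_inner_mul_inner x x
  have h' : HasSum (fun i => ‖⟪b i, x⟫_ℂ‖ ^ 2) (‖x‖ ^ 2) := by
    have h2 := RCLike.hasSum_re ℂ h
    convert h2 using 1
    · funext i
      rw [inner_mul_symm_re_eq_norm, norm_mul, norm_inner_symm x (b i), sq]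
    · rw [inner_self_eq_norm_sq]
  rw [← h'.tsum_eq, ENNReal.ofReal_tsum_of_nonneg (fun _ => by positivity) h'.summable]

/-- The trace of a positive operator does not depend on the orthonormal basis. -/
theorem posTrace_eq_tsum {ι : Type*} (b : HilbertBasis ι ℂ H) {A : H →L[ℂ] H} (hA : 0 ≤ A) :
    posTrace A = ∑' i, ENNReal.ofReal (RCLike.re ⟪b i, A (b i)⟫_ℂ) := by
  have key : ∀ x : H, RCLike.re ⟪x, A x⟫_ℂ = ‖CFC.sqrt A x‖ ^ 2 := by
    intro x
    have hs : IsSelfAdjoint (CFC.sqrt A) := (CFC.sqrt_nonneg A).isSelfAdjoint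
    conv_lhs => rw [← CFC.sqrt_mul_sqrt_self A hA]
    rw [mul_apply_eq_comp, ← ContinuousLinearMap.adjoint_inner_left,
      ContinuousLinearMap.isSelfAdjoint_iff'.mp hs, inner_self_eq_norm_sq]
  have swap : ∀ x y : H, ‖⟪x, CFC.sqrt A y⟫_ℂ‖ = ‖⟪y, CFC.sqrt A x⟫_ℂ‖ := by
    intro x y
    have hs : IsSelfAdjoint (CFC.sqrt A) := (CFC.sqrt_nonneg A).isSelfAdjoint
    rw [← ContinuousLinearMap.adjoint_inner_left, ContinuousLinearMap.isSelfAdjoint_iff'.mp hs,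
      norm_inner_symm]
  unfold posTrace
  generalize (exists_hilbertBasis ℂ H).choose_spec.choose = c
  simp_rw [key, ← tsum_normSq b (CFC.sqrt A (c _)), ← tsum_normSq c (CFC.sqrt A (b _))]
  rw [ENNReal.tsum_comm]
  simp_rw [swap (b _) (c _)]

/-- `P = (T₁* T₁ + ⋯ + T_d* T_d)^{1/2}`, the modulus of the operator column `T : H → H^d`. -/
def modulus (T : Fin d → H →L[ℂ] H) : H →L[ℂ] H :=
  CFC.sqrt (∑ i, (T i).adjoint * T i)

/-- The tuple `T` belongs to the Schatten `p`-class: `tr (P ^ p) < ∞`, where `P ^ p` is given by the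
continuous functional calculus. -/
def MemSchatten (p : ℝ) (T : Fin d → H →L[ℂ] H) : Prop :=
  posTrace (modulus T ^ p) < ∞

/-- The spherical Schatten `p`-norm `(tr (P ^ p))^{1/p}` of a tuple in the Schatten `p`-class. -/
def schattenNorm (p : ℝ) (T : Fin d → H →L[ℂ] H) : ℝ :=
  (posTrace (modulus T ^ p)).toReal ^ (1 / p)

/-- `T = V P` is the canonical spherical polar decomposition of `T`: `T i = V i P` for all `i`, and
`V : H → H^d` is a partial isometry with initial space `(ker P)ᗮ`, i.e. `V₁* V₁ + ⋯ + V_d* V_d` is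
the orthogonal projection onto `(ker P)ᗮ`. -/
def IsPolarFactor (T V : Fin d → H →L[ℂ] H) : Prop :=
  (∀ i, T i = V i * modulus T) ∧
    ∑ i, (V i).adjoint * V i = (modulus T).kerᗮ.starProjection

theorem inner_sum_adjoint_mul (T : Fin d → H →L[ℂ] H) (x : H) :
    ⟪(∑ i, (T i).adjoint * T i) x, x⟫_ℂ = ((∑ i, ‖T i x‖ ^ 2 : ℝ) : ℂ) := by
  simp [ContinuousLinearMap.adjoint_inner_left,
    inner_self_eq_norm_sq_to_K]

theorem sum_adjoint_mul_nonneg (T : Fin d → H →L[ℂ] H) : 0 ≤ ∑ i, (T i).adjoint * T i :=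
  Finset.sum_nonneg fun i _ => star_mul_self_nonneg (T i)

theorem modulus_isSelfAdjoint (T : Fin d → H →L[ℂ] H) : IsSelfAdjoint (modulus T) :=
  (CFC.sqrt_nonneg _).isSelfAdjoint

theorem norm_modulus_sq (T : Fin d → H →L[ℂ] H) (x : H) :
    ‖modulus T x‖ ^ 2 = ∑ i, ‖T i x‖ ^ 2 := by
  have h := inner_sum_adjoint_mul T x
  rw [← CFC.sqrt_mul_sqrt_self _ (sum_adjoint_mul_nonneg T)] at h
  change ⟪modulus T (modulus T x), x⟫_ℂ = _ at h
  rw [← ContinuousLinearMap.adjoint_inner_right,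
    ContinuousLinearMap.isSelfAdjoint_iff'.mp (modulus_isSelfAdjoint T),
    inner_self_eq_norm_sq_to_K] at h
  refine Complex.ofReal_injective (Eq.trans ?_ h)
  simp

theorem ker_modulus_orthogonal (T : Fin d → H →L[ℂ] H) :
    (modulus T).kerᗮ = (modulus T).range.topologicalClosure := by
  have h := ContinuousLinearMap.orthogonal_range (modulus T)
  rw [ContinuousLinearMap.isSelfAdjoint_iff'.mp (modulus_isSelfAdjoint T)] at h
  rw [← h, Submodule.orthogonal_orthogonal_eq_closure]

theorem IsPolarFactor.apply_eq_zero {T V : Fin d → H →L[ℂ] H} (h : IsPolarFactor T V)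
    {x : H} (hx : x ∈ (modulus T).ker) (i : Fin d) : V i x = 0 := by
  have h1 := inner_sum_adjoint_mul V x
  rw [h.2, (Submodule.starProjection_apply_eq_zero_iff _).mpr
    (Submodule.le_orthogonal_orthogonal _ hx), inner_zero_left] at h1
  have h2 : ∑ i, ‖V i x‖ ^ 2 = 0 := by exact_mod_cast h1.symm
  have h3 := (Finset.sum_eq_zero_iff_of_nonneg (fun i _ => by positivity)).mp h2 i
    (Finset.mem_univ i)
  simpa using h3

/-- The canonical spherical polar decomposition exists and is unique. -/
theorem existsUnique_polarFactor (T : Fin d → H →L[ℂ] H) : ∃! V, IsPolarFactor T V := by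
  set P := modulus T with hP
  set K := P.kerᗮ with hK
  have hKc : K = P.range.topologicalClosure := ker_modulus_orthogonal T
  have hmem : ∀ x, P x ∈ K := fun x => by
    rw [hKc]; exact Submodule.le_topologicalClosure _ ⟨x, rfl⟩
  refine existsUnique_of_exists_of_unique ?_ ?_
  · let e : H →ₗ[ℂ] K := (P : H →ₗ[ℂ] H).codRestrict K hmem
    have hdense : DenseRange e := by
      intro y
      have hy : (y : H) ∈ closure (P.range : Set H) := by
        have hy' : (y : H) ∈ P.range.topologicalClosure := hKc.le y.2
        exact hy'
      rw [closure_subtype]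
      convert hy using 2
      ext z
      constructor
      · rintro ⟨_, ⟨x, rfl⟩, rfl⟩
        exact ⟨x, rfl⟩
      · rintro ⟨x, rfl⟩
        exact ⟨e x, ⟨x, rfl⟩, rfl⟩
    have hb : ∀ i, ∃ C, ∀ x, ‖(T i : H →ₗ[ℂ] H) x‖ ≤ C * ‖e x‖ := by
      refine fun i => ⟨1, fun x => ?_⟩
      rw [one_mul]
      change ‖T i x‖ ≤ ‖P x‖
      refine le_of_sq_le_sq ?_ (norm_nonneg _)
      rw [norm_modulus_sq]
      exact Finset.single_le_sum (f := fun i => ‖T i x‖ ^ 2) (fun i _ => by positivity)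
        (Finset.mem_univ i)
    let W : Fin d → K →L[ℂ] H := fun i => (T i : H →ₗ[ℂ] H).extendOfNorm e
    have hW : ∀ i x, W i (e x) = T i x := fun i x =>
      LinearMap.extendOfNorm_eq hdense (hb i) x
    have hWn : ∀ y : K, ∑ i, ‖W i y‖ ^ 2 = ‖y‖ ^ 2 := by
      intro y
      refine hdense.induction_on (p := fun y => ∑ i, ‖W i y‖ ^ 2 = ‖y‖ ^ 2) y
        (isClosed_eq (by fun_prop) (by fun_prop)) fun x => ?_
      simp only [hW]
      exact (norm_modulus_sq T x).symm
    refine ⟨fun i => W i ∘L K.orthogonalProjectionOnto, fun i => ?_, ?_⟩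
    · ext x
      change T i x = W i (K.orthogonalProjectionOnto (P x))
      have : K.orthogonalProjectionOnto (P x) = e x :=
        Submodule.orthogonalProjectionOnto_mem_subspace_eq_self (K := K) (e x)
      rw [this, hW]
    · refine ContinuousLinearMap.coe_injective ((ext_inner_map _ _).mp fun x => ?_)
      have h1 := inner_sum_adjoint_mul (fun i => W i ∘L K.orthogonalProjectionOnto) x
      refine Eq.trans h1 ?_
      have h2 := hWn (K.orthogonalProjectionOnto x)
      change ((∑ i, ‖W i (K.orthogonalProjectionOnto x)‖ ^ 2 : ℝ) : ℂ)
        = ⟪K.starProjection x, x⟫_ℂ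
      rw [h2]
      have h3 : ⟪K.starProjection x, x⟫_ℂ = ⟪K.starProjection x, K.starProjection x⟫_ℂ := by
        rw [Submodule.inner_starProjection_left_eq_right, Submodule.inner_starProjection_left_eq_right,
          Submodule.starProjection_eq_self_iff.mpr (Submodule.starProjection_apply_mem K x)]
      rw [h3, inner_self_eq_norm_sq_to_K]
      exact Complex.ofReal_pow _ _
  · intro V V' hV hV'
    funext i
    have hrange : ∀ y ∈ P.range.topologicalClosure, V i y = V' i y := by
      intro y hy
      refine closure_minimal (s := (P.range : Set H)) (t := {y | V i y = V' i y}) ?_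
        (isClosed_eq (by fun_prop) (by fun_prop)) hy
      rintro _ ⟨x, rfl⟩
      have := (hV.1 i).symm.trans (hV'.1 i)
      exact DFunLike.congr_fun this x
    ext x
    have hclosed : IsClosed (P.ker : Set H) := P.isClosed_ker
    have : CompleteSpace P.ker := hclosed.completeSpace_coe
    obtain ⟨y, hy, z, hz, rfl⟩ := P.ker.exists_add_mem_mem_orthogonal x
    rw [map_add, map_add, IsPolarFactor.apply_eq_zero hV hy,
      IsPolarFactor.apply_eq_zero hV' hy, hrange z (hKc ▸ hz)]

/-- The tuple `V` of the canonical spherical polar decomposition `T = V P`. -/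
def polarFactor (T : Fin d → H →L[ℂ] H) : Fin d → H →L[ℂ] H :=
  (existsUnique_polarFactor T).choose

theorem isPolarFactor_polarFactor (T : Fin d → H →L[ℂ] H) : IsPolarFactor T (polarFactor T) :=
  (existsUnique_polarFactor T).choose_spec.1

/-- The spherical Duggal transform `T^D = (P V₁, …, P V_d)`. -/
def duggal (T : Fin d → H →L[ℂ] H) : Fin d → H →L[ℂ] H :=
  fun i => modulus T * polarFactor T i

/-- The spherical `lam`-mean transform `M_lam(T) = lam T + (1 - lam) T^D`. -/
def lambdaMean (lam : ℝ) (T : Fin d → H →L[ℂ] H) : Fin d → H →L[ℂ] H :=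
  (lam : ℂ) • T + ((1 - lam : ℝ) : ℂ) • duggal T

/-- The spherical mean transform `(T + T^D) / 2`. -/
def meanTransform (T : Fin d → H →L[ℂ] H) : Fin d → H →L[ℂ] H :=
  (1 / 2 : ℂ) • (T + duggal T)

end SphericalSchatten

end

noncomputable section
namespace SphericalSchatten

/-! ### Inequalities for sums in `[0, ∞]` -/

/-! Write `M` for the mean `lambdaMean lam T`, `P` for the modulus of `T`, and `V`, `W` for the
polar factors of `T` and `M`. Trace-class powers force compactness, so `P` and the modulus of `M`
have orthonormal eigenbases `b`, `c`, with eigenvalues `s`, `q`, and the two traces are sums of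
`p`-th powers of these eigenvalues.

Since `W` is isometric on the range of the modulus of `M`, `q n` equals `∑ i, ⟪W i (c n), M i (c
n)⟫`. This splits into `lam` times the terms `⟪W i (c n), V i (P (c n))⟫` plus `1 - lam` times the
terms `⟪W i (c n), P (V i (c n))⟫`, and Minkowski's inequality in `ℓ^p` treats the two families
separately.

In each family, expanding in `b` bounds the n-th term by a nonnegative matrix applied to `s`, and
`tsum_rpow_le_of_schur` makes that matrix an `ℓ^p` contraction. In the first family
(`tsum_enorm_inner_mul_right_rpow_le`) the tuples merge into one contraction `∑ V i* W i`, which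
gives constant 1. In the second (`tsum_enorm_inner_mul_left_rpow_le`) `P` separates them, so each
eigenvalue is used once per coordinate; this repetition produces `d ^ (1 / p)`. -/

/-- Jensen's inequality for `t ↦ t ^ p`; total mass below one is harmless because `p ≥ 1`. -/
theorem tsum_mul_rpow_le {κ : Type*} {p : ℝ} (hp : 1 ≤ p) (w f : κ → ℝ≥0∞)
    (hw : ∑' k, w k ≤ 1) : (∑' k, w k * f k) ^ p ≤ ∑' k, w k * f k ^ p := by
  have hp0 : 0 < p := by linarith
  rw [← ENNReal.le_rpow_inv_iff hp0, ENNReal.tsum_eq_iSup_sum]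
  refine iSup_le fun s => (ENNReal.inner_le_weight_mul_Lp_of_nonneg s hp w f).trans ?_
  have h1 : (∑ i ∈ s, w i) ^ (1 - p⁻¹) ≤ 1 :=
    ENNReal.rpow_le_one ((ENNReal.sum_le_tsum s).trans hw)
      (sub_nonneg.mpr (inv_le_one_of_one_le₀ hp))
  calc _ ≤ 1 * (∑ i ∈ s, w i * f i ^ p) ^ p⁻¹ := by gcongr
    _ ≤ _ := by
      rw [one_mul]
      exact ENNReal.rpow_le_rpow (ENNReal.sum_le_tsum s) (by positivity)

/-- The Cauchy–Schwarz inequality for families of square sum at most one. -/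
theorem tsum_mul_le_one {κ : Type*} (u v : κ → ℝ≥0∞) (hu : ∑' k, u k ^ (2 : ℝ) ≤ 1)
    (hv : ∑' k, v k ^ (2 : ℝ) ≤ 1) : ∑' k, u k * v k ≤ 1 := by
  rw [ENNReal.tsum_eq_iSup_sum]
  refine iSup_le fun s => ?_
  refine (ENNReal.inner_le_Lp_mul_Lq s u v Real.HolderConjugate.two_two).trans ?_
  exact mul_le_one' (ENNReal.rpow_le_one ((ENNReal.sum_le_tsum s).trans hu) (by norm_num))
    (ENNReal.rpow_le_one ((ENNReal.sum_le_tsum s).trans hv) (by norm_num))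

/-- A Schur-type test: a matrix that is the entrywise product of two matrices with rows and columns
in the unit ball of `ℓ²` is a contraction of `ℓ^p`. -/
theorem tsum_rpow_le_of_schur {ν κ : Type*} {p : ℝ} (hp : 1 ≤ p) (a : ν → ℝ≥0∞) (s : κ → ℝ≥0∞)
    (u v : ν → κ → ℝ≥0∞) (ha : ∀ n, a n ≤ ∑' k, u n k * v n k * s k)
    (hu : ∀ n, ∑' k, u n k ^ (2 : ℝ) ≤ 1) (hv : ∀ n, ∑' k, v n k ^ (2 : ℝ) ≤ 1)
    (hu' : ∀ k, ∑' n, u n k ^ (2 : ℝ) ≤ 1) (hv' : ∀ k, ∑' n, v n k ^ (2 : ℝ) ≤ 1) :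
    ∑' n, a n ^ p ≤ ∑' k, s k ^ p := by
  calc ∑' n, a n ^ p ≤ ∑' n, ∑' k, u n k * v n k * s k ^ p := by
        refine ENNReal.tsum_le_tsum fun n => ?_
        exact (ENNReal.rpow_le_rpow (ha n) (by linarith)).trans
          (tsum_mul_rpow_le hp _ _ (tsum_mul_le_one _ _ (hu n) (hv n)))
    _ = ∑' k, (∑' n, u n k * v n k) * s k ^ p := by
        rw [ENNReal.tsum_comm]
        simp_rw [ENNReal.tsum_mul_right]
    _ ≤ ∑' k, s k ^ p := by
        refine ENNReal.tsum_le_tsum fun k => ?_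
        exact mul_le_of_le_one_left' (tsum_mul_le_one _ _ (hu' k) (hv' k))

/-- The Minkowski inequality for sums in `[0, ∞]` over an arbitrary index type. -/
theorem Lp_add_le_tsum_ennreal {ν : Type*} {p : ℝ} (hp : 1 ≤ p) (f g : ν → ℝ≥0∞) :
    (∑' n, (f n + g n) ^ p) ^ (1 / p) ≤
      (∑' n, f n ^ p) ^ (1 / p) + (∑' n, g n ^ p) ^ (1 / p) := by
  have hp0 : 0 < p := by linarith
  rw [one_div, ENNReal.rpow_inv_le_iff hp0, ENNReal.tsum_eq_iSup_sum]
  refine iSup_le fun s => ?_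
  rw [← ENNReal.rpow_inv_le_iff hp0]
  refine (one_div p ▸ ENNReal.Lp_add_le s f g hp).trans ?_
  gcongr <;> exact ENNReal.sum_le_tsum s

theorem Lp_const_mul_tsum {ν : Type*} {p : ℝ} (hp : 1 ≤ p) (c : ℝ≥0∞) (f : ν → ℝ≥0∞) :
    (∑' n, (c * f n) ^ p) ^ (1 / p) = c * (∑' n, f n ^ p) ^ (1 / p) := by
  have hp0 : 0 < p := by linarith
  simp_rw [ENNReal.mul_rpow_of_nonneg _ _ hp0.le]
  rw [ENNReal.tsum_mul_left, ENNReal.mul_rpow_of_nonneg _ _ (by positivity), ← ENNReal.rpow_mul,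
    mul_one_div_cancel hp0.ne', ENNReal.rpow_one]

universe u
variable {H : Type u} [NormedAddCommGroup H] [InnerProductSpace ℂ H] [CompleteSpace H] {d : ℕ}

/-! ### Diagonalizable operators -/

theorem cfc_apply_eigenvector {A : H →L[ℂ] H} (hA : IsSelfAdjoint A) {f : ℝ → ℝ}
    (hf : ContinuousOn f (spectrum ℝ A)) {x : H} {s : ℝ} (hx : A x = (s : ℂ) • x) :
    cfc f A x = (f s : ℂ) • x := by
  rcases eq_or_ne x 0 with rfl | hx0
  · simp
  -- A nonzero eigenvector rules out invertibility of `s - A`, so evaluation at `s` makes sense on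
  -- functions on the spectrum.
  have hs : s ∈ spectrum ℝ A := by
    rintro ⟨u, hu⟩
    have h1 : (algebraMap ℝ (H →L[ℂ] H) s - A) x = 0 := by
      rw [sub_apply, hx, Algebra.algebraMap_eq_smul_one]
      simp
    rw [← hu] at h1
    have h2 : ((↑u⁻¹ : H →L[ℂ] H) * ↑u) x = 0 := by
      rw [mul_apply_eq_comp, h1, map_zero]
    rw [Units.inv_mul] at h2
    exact hx0 h2
  rw [cfc_apply f A hA hf]
  have key : ∀ g : C(spectrum ℝ A, ℝ), cfcHom hA g x = ((g ⟨s, hs⟩ : ℝ) : ℂ) • x := by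
    intro g
    -- Stone–Weierstrass: the identity is multiplicative in `g`, holds for the generators, and is a
    -- closed condition.
    induction g using ContinuousMap.induction_on_of_compact with
    | const r =>
      have : cfcHom hA (ContinuousMap.const _ r) = algebraMap ℝ (H →L[ℂ] H) r :=
        AlgHomClass.commutes (cfcHom hA) r
      rw [this, Algebra.algebraMap_eq_smul_one]
      simp
    | id => rw [cfcHom_id hA]; exact hx
    | star_id => rw [map_star, cfcHom_id hA, hA.star_eq]; exact hx
    | add f g hf hg => simp [map_add, hf, hg, add_smul]
    | mul f g hf hg =>
      rw [map_mul, mul_apply_eq_comp, hg, map_smul, hf, smul_smul]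
      simp [mul_comm]
    | frequently f hf =>
      have hc : IsClosed {g : C(spectrum ℝ A, ℝ) |
          cfcHom hA g x = ((g ⟨s, hs⟩ : ℝ) : ℂ) • x} := by
        have := cfcHom_continuous (R := ℝ) hA
        refine isClosed_eq (by fun_prop) ?_
        have : Continuous fun g : C(spectrum ℝ A, ℝ) => g ⟨s, hs⟩ :=
          by fun_prop
        fun_prop
      exact hc.mem_of_frequently_of_tendsto hf Filter.tendsto_id
  exact key _

open scoped NNReal in
theorem rpow_apply_eigenvector {A : H →L[ℂ] H} (hA : 0 ≤ A) {p : ℝ} (hp : 0 ≤ p) {x : H} {s : ℝ≥0}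
    (hx : A x = ((s : ℝ) : ℂ) • x) : (A ^ p) x = (((s ^ p : ℝ≥0) : ℝ) : ℂ) • x := by
  rw [CFC.rpow_eq_cfc_real hA, cfc_apply_eigenvector hA.isSelfAdjoint
    (Real.continuous_rpow_const hp).continuousOn hx, NNReal.coe_rpow]

open scoped NNReal ComplexOrder in
/-- The spectral theorem for positive compact operators. -/
theorem exists_eigenbasis {A : H →L[ℂ] H} (hA : 0 ≤ A) (hc : IsCompactOperator A) :
    ∃ (ι : Type u) (b : HilbertBasis ι ℂ H) (s : ι → ℝ≥0), ∀ k, A (b k) = ((s k : ℝ) : ℂ) • b k := by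
  have hsym : (A : H →ₗ[ℂ] H).IsSymmetric :=
    ContinuousLinearMap.isSelfAdjoint_iff_isSymmetric.mp hA.isSelfAdjoint
  let E : ℂ → Submodule ℂ H := fun μ => Module.End.eigenspace (A : Module.End ℂ H) μ
  have hEc : ∀ μ, CompleteSpace (E μ) := fun μ => by
    have : IsClosed (E μ : Set H) := by
      have h : (E μ : Set H) = {x | A x = μ • x} := by
        ext x; exact Module.End.mem_eigenspace_iff
      rw [h]
      exact isClosed_eq (by fun_prop) (by fun_prop)
    exact this.completeSpace_coe
  -- Bases of all the eigenspaces are glued together; a `μ` that is not an eigenvalue contributes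
  -- nothing.
  choose w b hb using fun μ => exists_hilbertBasis ℂ (E μ)
  have hv := hsym.orthogonalFamily_eigenspaces.orthonormal_sigma_orthonormal
    (v_family := fun μ => b μ) fun μ => (b μ).orthonormal
  have hbot := ContinuousLinearMap.orthogonalComplement_iSup_eigenspaces_eq_bot hc hsym
  have hspan : (Submodule.span ℂ (Set.range fun a : Σ μ, w μ => ((b a.1 a.2 : E a.1) : H)))ᗮ = ⊥ := by
    rw [eq_bot_iff, ← hbot]
    intro x hx
    rw [Submodule.mem_orthogonal] at hx
    rw [← Submodule.iInf_orthogonal, Submodule.mem_iInf]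
    intro μ
    rw [Submodule.mem_orthogonal]
    intro y hy
    have h1 := ((b μ).hasSum_repr ⟨y, hy⟩).mapL ((innerSL ℂ x) ∘L (E μ).subtypeL)
    have h2 : ∀ i, ⟪x, (b μ i : H)⟫_ℂ = 0 := fun i => by
      rw [← inner_conj_symm, hx _ (Submodule.subset_span ⟨⟨μ, i⟩, rfl⟩), map_zero]
    have h3 : ⟪x, y⟫_ℂ = 0 := by
      refine h1.unique ?_
      convert hasSum_zero using 2 with i
      simp [h2]
    rw [← inner_conj_symm, h3, map_zero]
  let B := HilbertBasis.mkOfOrthogonalEqBot hv hspan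
  have hB : ∀ k, B k = ((b k.1 k.2 : E k.1) : H) := fun k => by
    simp [B]
  have hBE : ∀ k, A (B k) = k.1 • B k := fun k => by
    rw [hB]; exact Module.End.mem_eigenspace_iff.mp (b k.1 k.2).2
  -- Positivity of `A` makes each eigenvalue equal to its own norm.
  refine ⟨_, B, fun k => ‖k.1‖₊, fun k => ?_⟩
  have hk : 0 ≤ k.1 := by
    have h1 := (ContinuousLinearMap.nonneg_iff_isPositive A).mp hA
    have h2 := h1.inner_nonneg_right (B k)
    rw [hBE, inner_smul_right, inner_self_eq_norm_sq_to_K, B.orthonormal.1 k] at h2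
    simpa using h2
  rw [hBE, coe_nnnorm]
  congr 1
  exact Complex.eq_coe_norm_of_nonneg hk

open scoped NNReal in
theorem posTrace_rpow_eq_tsum {ι : Type*} (b : HilbertBasis ι ℂ H) (s : ι → ℝ≥0)
    {A : H →L[ℂ] H} (hA : 0 ≤ A) (hb : ∀ k, A (b k) = ((s k : ℝ) : ℂ) • b k) {p : ℝ} (hp : 0 ≤ p) :
    posTrace (A ^ p) = ∑' k, (s k : ℝ≥0∞) ^ p := by
  rw [posTrace_eq_tsum b CFC.rpow_nonneg]
  refine tsum_congr fun k => ?_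
  rw [rpow_apply_eigenvector hA hp (hb k), inner_smul_right, inner_self_eq_norm_sq_to_K,
    b.orthonormal.1 k, ← ENNReal.coe_rpow_of_nonneg _ hp]
  rw [← ENNReal.ofReal_coe_nnreal (p := s k ^ p)]
  simp

/-! ### Compactness criteria -/

/-- Uniformly small tails mean that `A` is a norm limit of its finite-rank compressions to spans of
finitely many basis vectors. -/
theorem isCompactOperator_of_tail {ι : Type*} (b : HilbertBasis ι ℂ H) (A : H →L[ℂ] H)
    (h : ∀ ε > 0, ∃ F : Finset ι, ∀ x, ∑' k : {k // k ∉ F},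
      ENNReal.ofReal (‖⟪b k, A x⟫_ℂ‖ ^ 2) ≤ ENNReal.ofReal ((ε * ‖x‖) ^ 2)) :
    IsCompactOperator A := by
  have hcl := isClosed_setOfPred_isCompactOperator (σ₁₂ := RingHom.id ℂ) (M₁ := H) (M₂ := H)
  refine hcl.closure_subset (Metric.mem_closure_iff.mpr fun ε hε => ?_)
  obtain ⟨F, hF⟩ := h (ε / 2) (by positivity)
  let K := Submodule.span ℂ (b '' (F : Set ι))
  have hK : FiniteDimensional ℂ K := FiniteDimensional.span_of_finite ℂ (F.finite_toSet.image b)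
  have hPc : IsCompactOperator K.starProjection := by
    have : ProperSpace K := FiniteDimensional.proper ℂ K
    exact (isCompactOperator_of_locallyCompactSpace_rng K.subtypeL).comp_clm
      K.orthogonalProjectionOnto
  refine ⟨K.starProjection ∘L A, hPc.comp_clm A, ?_⟩
  rw [dist_eq_norm]
  refine lt_of_le_of_lt (ContinuousLinearMap.opNorm_le_bound _ (by positivity) fun x => ?_)
    (half_lt_self hε)
  refine abs_le_of_sq_le_sq' (b := ε / 2 * ‖x‖) ?_ (by positivity) |>.2
  rw [← ENNReal.ofReal_le_ofReal_iff (by positivity), ← tsum_normSq b]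
  refine le_trans ?_ (hF x)
  have hin : ∀ k ∈ F, ⟪b k, (A - K.starProjection ∘L A) x⟫_ℂ = 0 := fun k hk =>
    (Submodule.mem_orthogonal K _).mp (K.sub_starProjection_mem_orthogonal (A x)) _
      (Submodule.subset_span ⟨k, hk, rfl⟩)
  have hout : ∀ k ∉ F, ⟪b k, (A - K.starProjection ∘L A) x⟫_ℂ = ⟪b k, A x⟫_ℂ := fun k hk => by
    have hle : K ≤ (ℂ ∙ b k)ᗮ := by
      refine Submodule.span_le.mpr ?_
      rintro _ ⟨j, hj, rfl⟩
      exact Submodule.mem_orthogonal_singleton_iff_inner_right.mpr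
        (b.orthonormal.2 fun h => hk (h ▸ hj))
    have : ⟪b k, K.starProjection (A x)⟫_ℂ = 0 :=
      Submodule.mem_orthogonal_singleton_iff_inner_right.mp (hle (K.starProjection_apply_mem _))
    rw [sub_apply, inner_sub_right]
    exact (congrArg _ this).trans (sub_zero _)
  rw [← tsum_subtype_eq_of_support_subset (s := {k | k ∉ F})]
  · exact ENNReal.tsum_le_tsum fun k => by rw [hout k k.2]
  · intro k hk hkF
    exact hk (by simp only [hin k hkF]; simp)

theorem isCompactOperator_of_hilbertSchmidt {ι : Type*} (b : HilbertBasis ι ℂ H) {A : H →L[ℂ] H}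
    (hA : IsSelfAdjoint A) (h : ∑' k, ENNReal.ofReal (‖A (b k)‖ ^ 2) ≠ ∞) :
    IsCompactOperator A := by
  refine isCompactOperator_of_tail b A fun ε hε => ?_
  have hlim := ENNReal.tendsto_tsum_compl_atTop_zero h
  -- By self-adjointness and Cauchy–Schwarz, coordinate `k` of `A x` is at most `‖A (b k)‖ * ‖x‖`,
  -- so a tail of the convergent series bounds the tail of `A x`.
  obtain ⟨F, hF⟩ := (hlim.eventually (gt_mem_nhds
    (ENNReal.ofReal_pos.mpr (pow_pos hε 2)))).exists
  refine ⟨F, fun x => ?_⟩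
  calc _ ≤ ∑' k : {k // k ∉ F}, ENNReal.ofReal (‖A (b k)‖ ^ 2) * ENNReal.ofReal (‖x‖ ^ 2) := by
        refine ENNReal.tsum_le_tsum fun k => ?_
        rw [← ENNReal.ofReal_mul (by positivity), ← mul_pow,
          ← ContinuousLinearMap.adjoint_inner_left, ContinuousLinearMap.isSelfAdjoint_iff'.mp hA]
        gcongr
        exact norm_inner_le_norm _ _
    _ ≤ _ := by
        rw [ENNReal.tsum_mul_right, mul_pow, ENNReal.ofReal_mul (by positivity)]
        gcongr

theorem inner_eigenvector_apply {A : H →L[ℂ] H} (hA : IsSelfAdjoint A) {e : H} {s : ℝ}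
    (he : A e = (s : ℂ) • e) (x : H) : ⟪e, A x⟫_ℂ = (s : ℂ) * ⟪e, x⟫_ℂ := by
  rw [← ContinuousLinearMap.adjoint_inner_left, ContinuousLinearMap.isSelfAdjoint_iff'.mp hA, he,
    inner_smul_left, Complex.conj_ofReal]

open scoped NNReal in
theorem isCompactOperator_of_eigenbasis {ι : Type*} (b : HilbertBasis ι ℂ H) (s : ι → ℝ≥0)
    {A : H →L[ℂ] H} (hA : IsSelfAdjoint A) (hb : ∀ k, A (b k) = ((s k : ℝ) : ℂ) • b k)
    {p : ℝ} (hp : 0 < p) (h : ∑' k, (s k : ℝ≥0∞) ^ p ≠ ∞) : IsCompactOperator A := by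
  refine isCompactOperator_of_tail b A fun ε hε => ?_
  have hε' : ENNReal.ofReal ε ^ p ≠ 0 := by
    rw [Ne, ENNReal.rpow_eq_zero_iff_of_pos hp]
    simpa using hε
  -- Summability leaves only finitely many eigenvalues that are at least `ε`.
  refine ⟨(ENNReal.finite_const_le_of_tsum_ne_top h hε').toFinset, fun x => ?_⟩
  calc _ ≤ ∑' k : {k // k ∉ (ENNReal.finite_const_le_of_tsum_ne_top h hε').toFinset},
        ENNReal.ofReal (ε ^ 2) * ENNReal.ofReal (‖⟪b k, x⟫_ℂ‖ ^ 2) := by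
        refine ENNReal.tsum_le_tsum fun k => ?_
        have hk := k.2
        simp only [Set.Finite.mem_toFinset, Set.mem_ofPred_eq, not_le] at hk
        rw [ENNReal.rpow_lt_rpow_iff hp, ENNReal.lt_ofReal_iff_toReal_lt ENNReal.coe_ne_top] at hk
        rw [← ENNReal.ofReal_mul (by positivity), ← mul_pow, inner_eigenvector_apply hA (hb k),
          norm_mul]
        gcongr
        simpa using hk.le
    _ ≤ ENNReal.ofReal (ε ^ 2) * ENNReal.ofReal (‖x‖ ^ 2) := by
        rw [ENNReal.tsum_mul_left, ← tsum_normSq b x]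
        gcongr
        exact ENNReal.tsum_comp_le_tsum_of_injective Subtype.val_injective
          fun k => ENNReal.ofReal (‖⟪b k, x⟫_ℂ‖ ^ 2)
    _ = _ := by rw [mul_pow, ENNReal.ofReal_mul (by positivity)]

/-- The trace of `A` is the squared Hilbert–Schmidt norm of its square root. -/
theorem isCompactOperator_sqrt_of_posTrace {A : H →L[ℂ] H} (hA : 0 ≤ A) (h : posTrace A ≠ ∞) :
    IsCompactOperator ⇑(CFC.sqrt A : H →L[ℂ] H) := by
  obtain ⟨w, b, -⟩ := exists_hilbertBasis ℂ H
  have hs : IsSelfAdjoint (CFC.sqrt A) := (CFC.sqrt_nonneg A).isSelfAdjoint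
  refine isCompactOperator_of_hilbertSchmidt b hs ?_
  rw [posTrace_eq_tsum b hA] at h
  refine (tsum_congr fun k => congrArg ENNReal.ofReal ?_).trans_ne h
  conv_rhs => rw [← CFC.sqrt_mul_sqrt_self A hA]
  rw [mul_apply_eq_comp, ← ContinuousLinearMap.adjoint_inner_left,
    ContinuousLinearMap.isSelfAdjoint_iff'.mp hs, inner_self_eq_norm_sq]

open scoped NNReal in
/-- A positive operator in a Schatten class has an orthonormal basis of eigenvectors. -/
theorem exists_eigenbasis_of_posTrace_rpow {A : H →L[ℂ] H} (hA : 0 ≤ A) {p : ℝ} (hp : 0 < p)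
    (h : posTrace (A ^ p) ≠ ∞) :
    ∃ (ι : Type u) (b : HilbertBasis ι ℂ H) (s : ι → ℝ≥0),
      ∀ k, A (b k) = ((s k : ℝ) : ℂ) • b k := by
  have hAp : 0 ≤ A ^ p := CFC.rpow_nonneg
  have hc : IsCompactOperator ⇑(A ^ p : H →L[ℂ] H) := by
    rw [← CFC.sqrt_mul_sqrt_self (A ^ p) hAp]
    exact (isCompactOperator_sqrt_of_posTrace hAp h).comp_clm (CFC.sqrt (A ^ p))
  obtain ⟨ι, b, r, hb⟩ := exists_eigenbasis hAp hc
  -- Eigenvectors of the compact operator `A ^ p` are eigenvectors of `A`, recovered as its power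
  -- with exponent `p⁻¹`.
  refine ⟨ι, b, fun k => r k ^ p⁻¹, fun k => ?_⟩
  have h1 := rpow_apply_eigenvector hAp (inv_nonneg.mpr hp.le) (hb k)
  rwa [CFC.rpow_rpow_of_exponent_nonneg A p p⁻¹ hp.le (by positivity) hA,
    mul_inv_cancel₀ hp.ne', CFC.rpow_one A hA] at h1

/-! ### Parseval identities and matrix coefficients in `[0, ∞]` -/

theorem enorm_rpow_two {E : Type*} [SeminormedAddCommGroup E] (x : E) :
    ‖x‖ₑ ^ (2 : ℝ) = ENNReal.ofReal (‖x‖ ^ 2) := by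
  rw [← ofReal_norm, ENNReal.ofReal_rpow_of_nonneg (norm_nonneg x) two_pos.le, Real.rpow_two]

theorem tsum_enorm_inner {ι : Type*} (b : HilbertBasis ι ℂ H) (x : H) :
    ∑' k, ‖⟪b k, x⟫_ℂ‖ₑ ^ (2 : ℝ) = ‖x‖ₑ ^ (2 : ℝ) := by
  simp_rw [enorm_rpow_two]
  exact tsum_normSq b x

theorem tsum_enorm_inner_apply {ι : Type*} (b : HilbertBasis ι ℂ H) (A : H →L[ℂ] H) (x : H) :
    ∑' k, ‖⟪x, A (b k)⟫_ℂ‖ₑ ^ (2 : ℝ) = ‖A.adjoint x‖ₑ ^ (2 : ℝ) := by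
  rw [← tsum_enorm_inner b]
  refine tsum_congr fun k => ?_
  rw [ContinuousLinearMap.adjoint_inner_right, ← ofReal_norm, ← ofReal_norm, norm_inner_symm]

open scoped NNReal in
theorem enorm_inner_apply_le {ι : Type*} (b : HilbertBasis ι ℂ H) (s : ι → ℝ≥0)
    {A : H →L[ℂ] H} (hA : IsSelfAdjoint A) (hb : ∀ k, A (b k) = ((s k : ℝ) : ℂ) • b k) (y x : H) :
    ‖⟪y, A x⟫_ℂ‖ₑ ≤ ∑' k, ‖⟪b k, x⟫_ℂ‖ₑ * ‖⟪b k, y⟫_ℂ‖ₑ * s k := by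
  rw [← b.tsum_inner_mul_inner y (A x)]
  refine enorm_tsum_le_tsum_enorm.trans (ENNReal.tsum_le_tsum fun k => le_of_eq ?_)
  rw [inner_eigenvector_apply hA (hb k), enorm_mul, enorm_mul, ← ofReal_norm ⟪y, b k⟫_ℂ,
    norm_inner_symm, ofReal_norm]
  have : ‖((s k : ℝ) : ℂ)‖ₑ = s k := by
    rw [← ofReal_norm]; simp
  rw [this]
  ring

/-! ### Spherical contractions -/

/-- The column `V : H → H^d` is a contraction. -/
def IsSphericalContraction (V : Fin d → H →L[ℂ] H) : Prop :=
  ∀ x, ∑ i, ‖V i x‖ ^ 2 ≤ ‖x‖ ^ 2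

theorem IsPolarFactor.isSphericalContraction {T V : Fin d → H →L[ℂ] H} (h : IsPolarFactor T V) :
    IsSphericalContraction V := fun x => by
  have h1 := inner_sum_adjoint_mul V x
  rw [h.2] at h1
  have h2 : (∑ i, ‖V i x‖ ^ 2 : ℝ) ≤ ‖((modulus T).kerᗮ.starProjection x)‖ * ‖x‖ := by
    refine le_trans ?_ (norm_inner_le_norm (𝕜 := ℂ) _ _)
    rw [h1, Complex.norm_real]
    exact le_abs_self _
  rw [sq]
  exact h2.trans (by gcongr; exact Submodule.norm_starProjection_apply_le _ x)

omit [CompleteSpace H] in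
theorem IsSphericalContraction.norm_apply_le {V : Fin d → H →L[ℂ] H}
    (hV : IsSphericalContraction V) (i : Fin d) (x : H) : ‖V i x‖ ≤ ‖x‖ :=
  le_of_sq_le_sq ((Finset.single_le_sum (f := fun i => ‖V i x‖ ^ 2) (fun i _ => by positivity)
    (Finset.mem_univ i)).trans (hV x)) (norm_nonneg _)

/-- The operator is the product of the column `W` with the adjoint of the column `V`; pairing its
value `z` with itself and applying Cauchy–Schwarz over `i` avoids the space `H^d`. -/
theorem IsSphericalContraction.norm_sum_adjoint_mul_apply_le {V W : Fin d → H →L[ℂ] H}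
    (hV : IsSphericalContraction V) (hW : IsSphericalContraction W) (x : H) :
    ‖(∑ i, (V i).adjoint * W i) x‖ ≤ ‖x‖ := by
  set z := (∑ i, (V i).adjoint * W i) x with hz
  have h1 : ⟪z, z⟫_ℂ = ∑ i, ⟪V i z, W i x⟫_ℂ := by
    conv_lhs => enter [3]; rw [hz]
    simp [ContinuousLinearMap.adjoint_inner_right]
  have h2 : ‖z‖ ^ 2 ≤ ∑ i, ‖V i z‖ * ‖W i x‖ := by
    have h3 : ‖⟪z, z⟫_ℂ‖ = ‖z‖ ^ 2 := by rw [inner_self_eq_norm_sq_to_K]; simp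
    rw [← h3, h1]
    exact norm_sum_le_of_le _ fun i _ => norm_inner_le_norm _ _
  have h4 : (‖z‖ ^ 2) ^ 2 ≤ ‖z‖ ^ 2 * ‖x‖ ^ 2 :=
    calc (‖z‖ ^ 2) ^ 2 ≤ (∑ i, ‖V i z‖ * ‖W i x‖) ^ 2 := by gcongr
      _ ≤ (∑ i, ‖V i z‖ ^ 2) * ∑ i, ‖W i x‖ ^ 2 := Finset.sum_mul_sq_le_sq_mul_sq _ _ _
      _ ≤ _ := mul_le_mul (hV z) (hW x) (by positivity) (by positivity)
  rcases eq_or_ne z 0 with h0 | h0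
  · rw [h0, norm_zero]; positivity
  · have : 0 < ‖z‖ ^ 2 := by positivity
    exact le_of_sq_le_sq (le_of_mul_le_mul_left (by rwa [sq (‖z‖ ^ 2)] at h4) this) (norm_nonneg _)

theorem enorm_sq_le_one {E : Type*} [SeminormedAddCommGroup E] {x y : E} (h : ‖x‖ ≤ ‖y‖) (hy : ‖y‖ = 1) : ‖x‖ₑ ^ (2 : ℝ) ≤ 1 := by
  rw [enorm_rpow_two, ENNReal.ofReal_le_one]
  nlinarith [norm_nonneg x]

theorem norm_adjoint_apply_le {A : H →L[ℂ] H} (hA : ∀ x, ‖A x‖ ≤ ‖x‖) (x : H) :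
    ‖A.adjoint x‖ ≤ ‖x‖ := by
  have h : ‖A‖ ≤ 1 := A.opNorm_le_bound zero_le_one fun x => by simpa using hA x
  calc _ ≤ ‖A.adjoint‖ * ‖x‖ := A.adjoint.le_opNorm x
    _ ≤ 1 * ‖x‖ := by gcongr; rwa [LinearIsometryEquiv.norm_map]
    _ = _ := one_mul _

open scoped NNReal in
-- With `A` innermost, all the `V i` and `W i` move to one side and form the single contraction `X`.
-- Parseval for `X` and its adjoint then gives the row and column bounds of the Schur test.
theorem tsum_enorm_inner_mul_right_rpow_le {ι ν : Type*} (b : HilbertBasis ι ℂ H)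
    (c : HilbertBasis ν ℂ H) (s : ι → ℝ≥0) {A : H →L[ℂ] H} (hA : IsSelfAdjoint A)
    (hb : ∀ k, A (b k) = ((s k : ℝ) : ℂ) • b k) {p : ℝ} (hp : 1 ≤ p) {V W : Fin d → H →L[ℂ] H}
    (hV : IsSphericalContraction V) (hW : IsSphericalContraction W) :
    ∑' n, ‖∑ i, ⟪W i (c n), V i (A (c n))⟫_ℂ‖ₑ ^ p ≤ ∑' k, (s k : ℝ≥0∞) ^ p := by
  set X := ∑ i, (V i).adjoint * W i
  have hX : ∀ x, ‖X x‖ ≤ ‖x‖ := hV.norm_sum_adjoint_mul_apply_le hW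
  refine tsum_rpow_le_of_schur hp _ _ (fun n k => ‖⟪b k, c n⟫_ℂ‖ₑ) (fun n k => ‖⟪b k, X (c n)⟫_ℂ‖ₑ)
    (fun n => ?_) (fun n => ?_) (fun n => ?_) (fun k => ?_) fun k => ?_
  · refine le_of_eq_of_le (congrArg _ ?_) (enorm_inner_apply_le b s hA hb (X (c n)) (c n))
    simp [X, ContinuousLinearMap.adjoint_inner_left]
  · rw [tsum_enorm_inner]
    exact enorm_sq_le_one le_rfl (c.orthonormal.1 n)
  · rw [tsum_enorm_inner]
    exact enorm_sq_le_one (hX _) (c.orthonormal.1 n)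
  · simp_rw [← ofReal_norm, norm_inner_symm (b k), ofReal_norm]
    rw [tsum_enorm_inner]
    exact enorm_sq_le_one le_rfl (b.orthonormal.1 k)
  · rw [tsum_enorm_inner_apply]
    exact enorm_sq_le_one (norm_adjoint_apply_le hX _) (b.orthonormal.1 k)

theorem IsSphericalContraction.tsum_enorm_inner_le {ι : Type*} (b : HilbertBasis ι ℂ H)
    {V : Fin d → H →L[ℂ] H} (hV : IsSphericalContraction V) {x : H} (hx : ‖x‖ = 1) :
    ∑' ik : Fin d × ι, ‖⟪b ik.2, V ik.1 x⟫_ℂ‖ₑ ^ (2 : ℝ) ≤ 1 := by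
  rw [ENNReal.tsum_prod (f := fun i k => ‖⟪b k, V i x⟫_ℂ‖ₑ ^ (2 : ℝ)), tsum_fintype]
  simp_rw [tsum_enorm_inner b, enorm_rpow_two]
  rw [← ENNReal.ofReal_sum_of_nonneg (fun i _ => by positivity), ENNReal.ofReal_le_one]
  exact (hV x).trans (by rw [hx, one_pow])

open scoped NNReal in
-- Here `A` lies between `V i` and `W i`, so the sum over `i` stays in the index set `Fin d × ι`.
-- Rows are bounded because the whole columns contract, and matrix columns because each coordinate
-- and its adjoint do.
theorem tsum_enorm_inner_mul_left_rpow_le {ι ν : Type*} (b : HilbertBasis ι ℂ H)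
    (c : HilbertBasis ν ℂ H) (s : ι → ℝ≥0) {A : H →L[ℂ] H} (hA : IsSelfAdjoint A)
    (hb : ∀ k, A (b k) = ((s k : ℝ) : ℂ) • b k) {p : ℝ} (hp : 1 ≤ p) {V W : Fin d → H →L[ℂ] H}
    (hV : IsSphericalContraction V) (hW : IsSphericalContraction W) :
    ∑' n, ‖∑ i, ⟪W i (c n), A (V i (c n))⟫_ℂ‖ₑ ^ p ≤ d * ∑' k, (s k : ℝ≥0∞) ^ p := by
  have hd : ∑' ik : Fin d × ι, (s ik.2 : ℝ≥0∞) ^ p = d * ∑' k, (s k : ℝ≥0∞) ^ p := by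
    rw [ENNReal.tsum_prod (f := fun _ k => (s k : ℝ≥0∞) ^ p), tsum_fintype]
    simp
  have hcol : ∀ {V : Fin d → H →L[ℂ] H}, IsSphericalContraction V → ∀ ik : Fin d × ι,
      ∑' n, ‖⟪b ik.2, V ik.1 (c n)⟫_ℂ‖ₑ ^ (2 : ℝ) ≤ 1 := fun hV ik => by
    rw [tsum_enorm_inner_apply]
    exact enorm_sq_le_one (norm_adjoint_apply_le (hV.norm_apply_le _) _) (b.orthonormal.1 _)
  rw [← hd]
  refine tsum_rpow_le_of_schur hp _ (fun ik : Fin d × ι => (s ik.2 : ℝ≥0∞))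
    (fun n ik => ‖⟪b ik.2, V ik.1 (c n)⟫_ℂ‖ₑ) (fun n ik => ‖⟪b ik.2, W ik.1 (c n)⟫_ℂ‖ₑ)
    (fun n => ?_) (fun n => hV.tsum_enorm_inner_le b (c.orthonormal.1 n))
    (fun n => hW.tsum_enorm_inner_le b (c.orthonormal.1 n)) (hcol hV) (hcol hW)
  rw [ENNReal.tsum_prod (f := fun i k => ‖⟪b k, V i (c n)⟫_ℂ‖ₑ * ‖⟪b k, W i (c n)⟫_ℂ‖ₑ * s k),
    tsum_fintype]
  exact (enorm_sum_le _ _).trans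
    (Finset.sum_le_sum fun i _ => enorm_inner_apply_le b s hA hb _ _)

/-! ### The mean transform -/

/-- `V* T = V* V P = P`, since `V* V` projects onto a space containing the range of `P`. This makes
the eigenvalues of a modulus linear in the tuple once its polar factor is fixed. -/
theorem IsPolarFactor.sum_inner_apply {T V : Fin d → H →L[ℂ] H} (h : IsPolarFactor T V) (x : H) :
    ∑ i, ⟪V i x, T i x⟫_ℂ = ⟪x, modulus T x⟫_ℂ := by
  have hm : modulus T x ∈ (modulus T).kerᗮ := by
    rw [ker_modulus_orthogonal]
    exact Submodule.le_topologicalClosure _ ⟨x, rfl⟩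
  have h1 : ⟪x, (∑ i, (V i).adjoint * V i) (modulus T x)⟫_ℂ = ⟪x, modulus T x⟫_ℂ := by
    rw [h.2, Submodule.starProjection_eq_self_iff.mpr hm]
  rw [← h1]
  simp only [sum_apply, inner_sum, mul_apply_eq_comp, ContinuousLinearMap.adjoint_inner_right]
  refine Finset.sum_congr rfl fun i _ => ?_
  conv_lhs => rw [h.1 i]
  rfl

open scoped NNReal in
/-- The modulus of a tuple of compact operators has an orthonormal basis of eigenvectors. -/
theorem exists_eigenbasis_modulus {M : Fin d → H →L[ℂ] H} (hM : ∀ i, IsCompactOperator (M i)) :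
    ∃ (ν : Type u) (c : HilbertBasis ν ℂ H) (q : ν → ℝ≥0),
      ∀ n, modulus M (c n) = ((q n : ℝ) : ℂ) • c n := by
  have h0 := sum_adjoint_mul_nonneg M
  have hc : IsCompactOperator ⇑(∑ i, (M i).adjoint * M i : H →L[ℂ] H) :=
    (compactOperator (RingHom.id ℂ) H H).sum_mem fun i _ => (hM i).clm_comp (M i).adjoint
  obtain ⟨ν, c, r, hr⟩ := exists_eigenbasis h0 hc
  -- The modulus is the square root of the compact positive operator just diagonalized.
  refine ⟨ν, c, fun n => r n ^ (1 / 2 : ℝ), fun n => ?_⟩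
  rw [modulus, CFC.sqrt_eq_rpow]
  exact rpow_apply_eigenvector h0 (by norm_num) (hr n)

theorem modulus_nonneg (T : Fin d → H →L[ℂ] H) : 0 ≤ modulus T := CFC.sqrt_nonneg _

theorem lambdaMean_apply (lam : ℝ) (T : Fin d → H →L[ℂ] H) (i : Fin d) (x : H) :
    lambdaMean lam T i x = (lam : ℂ) • polarFactor T i (modulus T x) +
      ((1 - lam : ℝ) : ℂ) • modulus T (polarFactor T i x) := by
  conv_lhs => rw [lambdaMean, Pi.add_apply, Pi.smul_apply, Pi.smul_apply,
    (isPolarFactor_polarFactor T).1 i]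
  rfl

theorem posTrace_lambdaMean_le {p : ℝ} (hp : 1 ≤ p) {T : Fin d → H →L[ℂ] H}
    (hT : MemSchatten p T) {lam : ℝ} (h0 : 0 ≤ lam) (h1 : lam ≤ 1) :
    posTrace (modulus (lambdaMean lam T) ^ p) ^ (1 / p) ≤
      (ENNReal.ofReal lam + ENNReal.ofReal (1 - lam) * (d : ℝ≥0∞) ^ (1 / p)) *
        posTrace (modulus T ^ p) ^ (1 / p) := by
  have hp0 : 0 < p := by linarith
  set P := modulus T
  set V := polarFactor T
  set M := lambdaMean lam T
  set W := polarFactor M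
  have hP : 0 ≤ P := modulus_nonneg T
  have hV := (isPolarFactor_polarFactor T).isSphericalContraction
  have hW := (isPolarFactor_polarFactor M).isSphericalContraction
  obtain ⟨ι, b, s, hb⟩ := exists_eigenbasis_of_posTrace_rpow hP hp0 hT.ne
  have htr := posTrace_rpow_eq_tsum b s hP hb hp0.le
  have hPc : IsCompactOperator P :=
    isCompactOperator_of_eigenbasis b s hP.isSelfAdjoint hb hp0 (htr ▸ hT.ne)
  have hMc : ∀ i, IsCompactOperator (M i) := fun i => by
    have := ((hPc.clm_comp (V i)).smul (lam : ℂ)).add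
      ((hPc.comp_clm (V i)).smul ((1 - lam : ℝ) : ℂ))
    have e : ⇑(M i) = _ := funext (lambdaMean_apply lam T i)
    rw [e]
    exact this
  obtain ⟨ν, c, q, hq⟩ := exists_eigenbasis_modulus hMc
  rw [htr, posTrace_rpow_eq_tsum c q (modulus_nonneg M) hq hp0.le]
  set α : ν → ℝ≥0∞ := fun n => ‖∑ i, ⟪W i (c n), V i (P (c n))⟫_ℂ‖ₑ
  set β : ν → ℝ≥0∞ := fun n => ‖∑ i, ⟪W i (c n), P (V i (c n))⟫_ℂ‖ₑ
  -- The factor `W` of `M` tests both summands of `M`, so the triangle inequality is needed only for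
  -- scalars.
  have hqn : ∀ n, (q n : ℝ≥0∞) ≤ ENNReal.ofReal lam * α n + ENNReal.ofReal (1 - lam) * β n := by
    intro n
    have e1 : ∑ i, ⟪W i (c n), M i (c n)⟫_ℂ = (q n : ℝ) := by
      rw [(isPolarFactor_polarFactor M).sum_inner_apply, hq, inner_smul_right,
        inner_self_eq_norm_sq_to_K, c.orthonormal.1 n]
      simp
    have e2 : (q n : ℝ≥0∞) = ‖∑ i, ⟪W i (c n), M i (c n)⟫_ℂ‖ₑ := by
      rw [e1, ← ofReal_norm]; simp
    have e3 : ∀ r : ℝ, 0 ≤ r → ‖(r : ℂ)‖ₑ = ENNReal.ofReal r := fun r hr => by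
      rw [← ofReal_norm, Complex.norm_of_nonneg hr]
    rw [e2, ← e3 lam h0, ← e3 (1 - lam) (by linarith), ← enorm_mul, ← enorm_mul]
    refine le_of_eq_of_le (congrArg _ ?_) (enorm_add_le _ _)
    rw [Finset.mul_sum, Finset.mul_sum, ← Finset.sum_add_distrib]
    refine Finset.sum_congr rfl fun i _ => ?_
    rw [lambdaMean_apply, inner_add_right, inner_smul_right, inner_smul_right]
  have hα : (∑' n, α n ^ p) ^ (1 / p) ≤ (∑' k, (s k : ℝ≥0∞) ^ p) ^ (1 / p) :=
    ENNReal.rpow_le_rpow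
      (tsum_enorm_inner_mul_right_rpow_le b c s hP.isSelfAdjoint hb hp hV hW) (by positivity)
  have hβ : (∑' n, β n ^ p) ^ (1 / p) ≤
      (d : ℝ≥0∞) ^ (1 / p) * (∑' k, (s k : ℝ≥0∞) ^ p) ^ (1 / p) := by
    rw [← ENNReal.mul_rpow_of_nonneg _ _ (by positivity)]
    exact ENNReal.rpow_le_rpow
      (tsum_enorm_inner_mul_left_rpow_le b c s hP.isSelfAdjoint hb hp hV hW) (by positivity)
  calc (∑' n, (q n : ℝ≥0∞) ^ p) ^ (1 / p)
      ≤ (∑' n, (ENNReal.ofReal lam * α n + ENNReal.ofReal (1 - lam) * β n) ^ p) ^ (1 / p) :=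
        ENNReal.rpow_le_rpow (ENNReal.tsum_le_tsum fun n =>
          ENNReal.rpow_le_rpow (hqn n) hp0.le) (by positivity)
    _ ≤ ENNReal.ofReal lam * (∑' n, α n ^ p) ^ (1 / p) +
        ENNReal.ofReal (1 - lam) * (∑' n, β n ^ p) ^ (1 / p) := by
        refine (Lp_add_le_tsum_ennreal hp _ _).trans_eq ?_
        rw [Lp_const_mul_tsum hp, Lp_const_mul_tsum hp]
    _ ≤ _ := by
        rw [add_mul, mul_assoc]
        gcongr

theorem lambdaMean_memSchatten_and_norm_le {p : ℝ} (hp : 1 ≤ p) {T : Fin d → H →L[ℂ] H}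
    (hT : MemSchatten p T) {lam : ℝ} (h0 : 0 ≤ lam) (h1 : lam ≤ 1) :
    MemSchatten p (lambdaMean lam T) ∧ schattenNorm p (lambdaMean lam T) ≤
      (lam + (1 - lam) * (d : ℝ) ^ (1 / p)) * schattenNorm p T := by
  have hp0 : 0 < p := by linarith
  have h := posTrace_lambdaMean_le hp hT h0 h1
  have hfin : (ENNReal.ofReal lam + ENNReal.ofReal (1 - lam) * (d : ℝ≥0∞) ^ (1 / p)) *
        posTrace (modulus T ^ p) ^ (1 / p) ≠ ∞ := by
    have h2 : (d : ℝ≥0∞) ^ (1 / p) ≠ ∞ :=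
      ENNReal.rpow_ne_top_of_nonneg (by positivity) (ENNReal.natCast_ne_top d)
    have h3 := ENNReal.rpow_ne_top_of_nonneg (y := 1 / p) (by positivity) hT.ne
    exact ENNReal.mul_ne_top (ENNReal.add_ne_top.mpr
      ⟨ENNReal.ofReal_ne_top, ENNReal.mul_ne_top ENNReal.ofReal_ne_top h2⟩) h3
  refine ⟨?_, ?_⟩
  -- The bound was proved in `[0, ∞]`, so membership follows from finiteness of its right-hand side.
  · have := h.trans_lt hfin.lt_top
    rwa [ENNReal.rpow_lt_top_iff_of_pos (by positivity)] at this
  · have h4 := ENNReal.toReal_mono hfin h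
    rw [ENNReal.toReal_mul, ENNReal.toReal_add ENNReal.ofReal_ne_top, ENNReal.toReal_mul,
      ENNReal.toReal_ofReal h0, ENNReal.toReal_ofReal (by linarith), ← ENNReal.toReal_rpow,
      ← ENNReal.toReal_rpow, ← ENNReal.toReal_rpow, ENNReal.toReal_natCast] at h4
    · exact h4
    · exact ENNReal.mul_ne_top ENNReal.ofReal_ne_top
        (ENNReal.rpow_ne_top_of_nonneg (by positivity) (ENNReal.natCast_ne_top d))

theorem lambdaMean_zero (T : Fin d → H →L[ℂ] H) : lambdaMean 0 T = duggal T := by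
  simp [lambdaMean]

theorem lambdaMean_one_half (T : Fin d → H →L[ℂ] H) : lambdaMean (1 / 2) T = meanTransform T := by
  rw [lambdaMean, meanTransform, smul_add]
  norm_num

end SphericalSchatten
end

theorem theorem3p5 {H : Type*} [NormedAddCommGroup H] [InnerProductSpace ℂ H] [CompleteSpace H]
    [TopologicalSpace.SeparableSpace H] {d : ℕ} (p : ℝ) (hp : 1 ≤ p)
    (T : Fin d → H →L[ℂ] H) (hT : SphericalSchatten.MemSchatten p T) :
    (∀ lam : ℝ, 0 ≤ lam → lam ≤ 1 →
      SphericalSchatten.MemSchatten p (SphericalSchatten.lambdaMean lam T) ∧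
      SphericalSchatten.schattenNorm p (SphericalSchatten.lambdaMean lam T) ≤
        (lam + (1 - lam) * (d : ℝ) ^ (1 / p)) * SphericalSchatten.schattenNorm p T) ∧
    (SphericalSchatten.MemSchatten p (SphericalSchatten.duggal T) ∧
      SphericalSchatten.schattenNorm p (SphericalSchatten.duggal T) ≤
        (d : ℝ) ^ (1 / p) * SphericalSchatten.schattenNorm p T) ∧
    (SphericalSchatten.MemSchatten p (SphericalSchatten.meanTransform T) ∧
      SphericalSchatten.schattenNorm p (SphericalSchatten.meanTransform T) ≤
        (1 + (d : ℝ) ^ (1 / p)) / 2 * SphericalSchatten.schattenNorm p T) := by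
  refine ⟨fun lam h0 h1 =>
    SphericalSchatten.lambdaMean_memSchatten_and_norm_le hp hT h0 h1, ?_, ?_⟩
  · have h := SphericalSchatten.lambdaMean_memSchatten_and_norm_le hp hT le_rfl zero_le_one
    rw [SphericalSchatten.lambdaMean_zero] at h
    exact ⟨h.1, h.2.trans_eq (by ring)⟩
  · have h := SphericalSchatten.lambdaMean_memSchatten_and_norm_le hp hT
      (lam := 1 / 2) (by norm_num) (by norm_num)
    rw [SphericalSchatten.lambdaMean_one_half] at h
    exact ⟨h.1, h.2.trans_eq (by ring)⟩
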